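/- Let $\mathbb T=\mathbb R/\mathbb Z$ with normalized Lebesgue measure $m$, let $k\ge 2$ be an integer, $T(x)=kx \bmod 1$, and let $H\in C^4(\mathbb T,\mathbb R)$. For $\delta>0$, a measurable map $S:\mathbb T\to\mathbb T$ and a Borel probability measure $\mu$ on $\mathbb T$, put $$\Phi_{\delta,\mu}(x)=x+\delta\int_{\mathbb T}H\,d\mu \bmod 1,\qquad \mathcal L_{\delta,S}(\mu)=S_*\big((\Phi_{\delta,\mu})_*\mu\big),$$ and identify a probability density $h$ with the measure $h\,m$. Let $W^{j,1}(\mathbb T)$ be the space of functions in $L^1(\mathbb T)$ whose weak derivatives up to order $j$ are in $L^1(\mathbb T)$, with $\|f\|_{W^{1,1}}=\|f\|_{L^1}+\|f'\|_{L^1}$. For each $\delta>0$ there are $\epsilon_0,C,\varrho,\lambda>0$, depending only on $k,H,\delta$, such that the following holds. Let $(T_\epsilon)_{0\le\epsilon\le\epsilon_0}$ be any family of maps $T_\epsilon\in C^4(\mathbb T,\mathbb T)$ with $\|T-T_\epsilon\|_{C^4}\le\epsilon$ (so $T_0=T$) for which there is $\sigma'>1$ with $T_\epsilon'(x)\ge\sigma'$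 for all $x\in\mathbb T$ and all $\epsilon\in[0,\epsilon_0]$; here $\|T-T_\epsilon\|_{C^4}$ is the maximum of the uniform distance between the maps and of the uniform distances between their derivatives of orders $1$ to $4$. Write $\mathcal L^{(\epsilon)}_\delta=\mathcal L_{\delta,T_\epsilon}$. Then for each $\epsilon\in[0,\epsilon_0]$, each probability density $h_\epsilon\in W^{3,1}(\mathbb T)$ with $\mathcal L^{(\epsilon)}_\delta h_\epsilon=h_\epsilon$, each probability density $\eta\in W^{1,1}(\mathbb T)$ with $\|h_\epsilon-\eta\|_{W^{1,1}}\le\varrho$ and each integer $n\ge 0$, the measure $[\mathcal L^{(\epsilon)}_\delta]^n\eta$ has a density in $W^{1,1}(\mathbb T)$ and $$\big\|h_\epsilon-[\mathcal L^{(\epsilon)}_\delta]^n\eta\big\|_{W^{1,1}}\le C e^{-\lambda n}.$$ -/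

import Mathlib

open MeasureTheory Set
open scoped ContDiff

namespace STO

/-- The circle `ℝ / ℤ`; its `volume` is the normalized Lebesgue measure. -/
abbrev Torus : Type := UnitAddCircle

/-! ### Sobolev spaces on the circle -/

/-- The function `φ : 𝕋 → ℝ` is of class `C^r`, i.e. its `1`-periodic lift to `ℝ` is. -/
def IsSmoothFun (r : ℕ∞) (φ : Torus → ℝ) : Prop :=
  ContDiff ℝ r (fun t : ℝ => φ (t : Torus))

/-- The classical derivative of a function on the circle. -/
noncomputable def torusDeriv (φ : Torus → ℝ) (x : Torus) : ℝ :=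
  deriv (fun t : ℝ => φ (x + (t : Torus))) 0

/-- `g ∈ L¹` is a weak derivative of `f ∈ L¹`. -/
def HasWeakDeriv (f g : Torus → ℝ) : Prop :=
  Integrable f volume ∧ Integrable g volume ∧
    ∀ φ : Torus → ℝ, IsSmoothFun ⊤ φ →
      ∫ x, f x * torusDeriv φ x = -∫ x, g x * φ x

/-- `f` belongs to the Sobolev space `W^{m,1}(𝕋)`. -/
def MemSobolev : ℕ → (Torus → ℝ) → Prop
  | 0, f => Integrable f volume
  | m + 1, f => ∃ g, HasWeakDeriv f g ∧ MemSobolev m g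

/-- The weak derivative of `f` (unique up to null sets when it exists). -/
noncomputable def weakDeriv (f : Torus → ℝ) : Torus → ℝ :=
  Classical.epsilon fun g => HasWeakDeriv f g

/-- The norm `‖f‖_{L¹} + ‖f'‖_{L¹}` of `f ∈ W^{1,1}(𝕋)`. -/
noncomputable def sobolevNorm (f : Torus → ℝ) : ℝ :=
  (∫ x, |f x|) + ∫ x, |weakDeriv f x|

/-! ### Densities and the self-consistent transfer operator -/

/-- `f` is a probability density with respect to Lebesgue measure on the circle. -/
def IsProbDensity (f : Torus → ℝ) : Prop :=
  Integrable f volume ∧ (∀ᵐ x, 0 ≤ f x) ∧ ∫ x, f x = 1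

/-- The measure with density `f` (used for probability densities `f`). -/
noncomputable def densityMeasure (f : Torus → ℝ) : Measure Torus :=
  (volume : Measure Torus).withDensity fun x => ENNReal.ofReal (f x)

/-- The mean-field coupling `Φ_{δ,μ}(x) = x + δ ∫ H dμ mod 1`. -/
noncomputable def coupling (δ : ℝ) (H : Torus → ℝ) (μ : Measure Torus) (x : Torus) : Torus :=
  x + ((δ * ∫ y, H y ∂μ : ℝ) : Torus)

/-- The self-consistent transfer operator `μ ↦ T_* ((Φ_{δ,μ})_* μ)`. -/
noncomputable def selfConsistentOp (δ : ℝ) (H : Torus → ℝ) (T : Torus → Torus)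
    (μ : Measure Torus) : Measure Torus :=
  (μ.map (coupling δ H μ)).map T

/-! ### Circle maps -/

/-- The linear expanding map `x ↦ k x mod 1`. -/
def linearMap (k : ℕ) (x : Torus) : Torus := k • x

/-- `F : ℝ → ℝ` is a lift of class `C⁴` of the circle map `S`; `S` is of class `C⁴` if and only if
it has such a lift, and any two lifts differ by an integer constant. -/
def IsC4Lift (F : ℝ → ℝ) (S : Torus → Torus) : Prop :=
  ContDiff ℝ 4 F ∧ ∀ t : ℝ, S (t : Torus) = ((F t : ℝ) : Torus)

/-- `S` and `S'` are `C⁴` circle maps with `‖S - S'‖_{C⁴} ≤ ε` (maximum of the uniform distance and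
of the uniform distances of the derivatives of order one to four). -/
def C4DistLE (S S' : Torus → Torus) (ε : ℝ) : Prop :=
  (∀ x, dist (S x) (S' x) ≤ ε) ∧
    ∃ F F' : ℝ → ℝ, IsC4Lift F S ∧ IsC4Lift F' S' ∧
      ∀ j ∈ Finset.Icc 1 4, ∀ t : ℝ, |iteratedDeriv j F t - iteratedDeriv j F' t| ≤ ε

/-- The `C⁴` circle map `S` has derivative at least `σ` everywhere. -/
def DerivGE (S : Torus → Torus) (σ : ℝ) : Prop :=
  ∃ F : ℝ → ℝ, IsC4Lift F S ∧ ∀ t : ℝ, σ ≤ deriv F t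

end STO

namespace STO

open Filter Topology


/-! ### Calculus on the circle through lifts -/

/-! Near the linear map, one step of the self-consistent operator contracts the `L¹` norm of the
derivative of `η - h`. With `w` the reciprocal of the derivative of the circle map, push-forward
sends `f` to a density whose weak derivative is the push-forward of `(f w)'`. Push-forward does not
increase `L¹` norms, so the new derivative is at most `4/7 ‖f'‖ + ε ‖f‖`, because `w ≤ 4/7` and
`|w'| ≤ ε` (`exists_isNearLinear`, `IsPush.hasWeakDeriv`). On mean-zero functions `poincare` bounds
`‖f‖` by `2 ‖f'‖`, and the `ε` term is harmless.

The nonlinearity enters because `η` and `h` are translated by different amounts `b` and `a` before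
the push-forward. These satisfy `|b - a| ≤ δ M ‖η - h‖`, with `M` a bound for `|H|`, and the
mismatch costs `|b - a| ‖h''‖` in the derivative. No smallness of `δ` is needed: an invariant
density nearly inherits the flatness of Lebesgue measure, `‖h''‖ ≤ 11 ε`
(`integral_abs_second_deriv_le`), so the cost is absorbed once `δ M ε` is small. The net factor is
at most `2/3` (`exists_contraction`), and iteration together with `poincare` gives the exponential
bound.

All Sobolev estimates are made by duality: an `L¹` norm is a supremum over continuous test functions
bounded by one (`integral_abs_le_of_dual`), so no pointwise representatives or sums over inverse
branches are required. -/

instance : IsProbabilityMeasure (volume : Measure Torus) :=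
  ⟨UnitAddCircle.measure_univ⟩

theorem torus_surj (x : Torus) : ∃ t : ℝ, (t : Torus) = x := QuotientAddGroup.mk_surjective x

theorem torusDeriv_coe (φ : Torus → ℝ) (t : ℝ) :
    torusDeriv φ (t : Torus) = deriv (fun s : ℝ => φ (s : Torus)) t := by
  have h := deriv_comp_const_add (f := fun s : ℝ => φ (s : Torus)) t 0
  simp only [add_zero] at h
  rw [← h]
  unfold torusDeriv
  congr 1

theorem continuous_of_lift {φ : Torus → ℝ} (h : Continuous fun t : ℝ => φ (t : Torus)) :
    Continuous φ :=
  (QuotientAddGroup.isQuotientMap_mk (AddSubgroup.zmultiples (1 : ℝ))).continuous_iff.2 h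

theorem continuous_lift {φ : Torus → ℝ} (h : Continuous φ) :
    Continuous fun t : ℝ => φ (t : Torus) :=
  h.comp (AddCircle.continuous_mk' 1)

theorem IsSmoothFun.continuous {r : ℕ∞} {φ : Torus → ℝ} (h : IsSmoothFun r φ) : Continuous φ :=
  continuous_of_lift (ContDiff.continuous h)

theorem IsSmoothFun.of_le {r s : ℕ∞} {φ : Torus → ℝ} (h : IsSmoothFun r φ) (hs : s ≤ r) :
    IsSmoothFun s φ :=
  ContDiff.of_le h (by exact_mod_cast hs)

theorem IsSmoothFun.contDiff_one {φ : Torus → ℝ} (h : IsSmoothFun 1 φ) :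
    ContDiff ℝ 1 (fun t : ℝ => φ (t : Torus)) := h

theorem IsSmoothFun.hasDerivAt {φ : Torus → ℝ} (h : IsSmoothFun 1 φ) (t : ℝ) :
    HasDerivAt (fun t : ℝ => φ (t : Torus)) (torusDeriv φ t) t := by
  rw [torusDeriv_coe]
  exact (h.contDiff_one.differentiable (by norm_num) t).hasDerivAt

theorem IsSmoothFun.continuous_torusDeriv {φ : Torus → ℝ} (h : IsSmoothFun 1 φ) :
    Continuous (torusDeriv φ) := by
  apply continuous_of_lift
  simp_rw [torusDeriv_coe]
  exact h.contDiff_one.continuous_deriv (by norm_num)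

/-- A function is `C¹` with a given derivative as soon as its lift is. -/
theorem isSmoothFun_one_of_hasDerivAt {φ ψ : Torus → ℝ} (hψ : Continuous ψ)
    (h : ∀ t : ℝ, HasDerivAt (fun t : ℝ => φ (t : Torus)) (ψ t) t) :
    IsSmoothFun 1 φ ∧ torusDeriv φ = ψ := by
  have hd : deriv (fun t : ℝ => φ (t : Torus)) = fun t : ℝ => ψ t := funext fun t => (h t).deriv
  refine ⟨?_, ?_⟩
  · have : ContDiff ℝ 1 (fun t : ℝ => φ (t : Torus)) :=
      contDiff_one_iff_deriv.2 ⟨fun t => (h t).differentiableAt, hd ▸ continuous_lift hψ⟩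
    exact this
  · funext x
    obtain ⟨t, rfl⟩ := torus_surj x
    rw [torusDeriv_coe, hd]

theorem _root_.Continuous.integrable_mul_torus {f φ : Torus → ℝ} (hφ : Continuous φ)
    (hf : Integrable f volume) : Integrable (fun x => f x * φ x) volume := by
  obtain ⟨C, hC⟩ := isCompact_univ.exists_bound_of_continuousOn hφ.continuousOn
  exact hf.mul_bdd (c := C) hφ.aestronglyMeasurable (Eventually.of_forall fun x => hC x (mem_univ x))

theorem exists_bound_torus {φ : Torus → ℝ} (hφ : Continuous φ) : ∃ C, 0 ≤ C ∧ ∀ x, |φ x| ≤ C := by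
  obtain ⟨C, hC⟩ := isCompact_univ.exists_bound_of_continuousOn hφ.continuousOn
  exact ⟨C, (norm_nonneg _).trans (hC 0 (mem_univ _)), fun x => hC x (mem_univ x)⟩

theorem exists_delta_lift {φ : Torus → ℝ} (hφ : Continuous φ) {ε : ℝ} (hε : 0 < ε) :
    ∃ r > 0, ∀ s t : ℝ, |s - t| < r → |φ (s : Torus) - φ (t : Torus)| < ε := by
  obtain ⟨r, hr, h⟩ := Metric.uniformContinuous_iff.1
    (CompactSpace.uniformContinuous_of_continuous hφ) ε hε
  refine ⟨r, hr, fun s t hst => h ?_⟩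
  rw [dist_eq_norm, ← AddCircle.coe_sub]
  exact (QuotientAddGroup.norm_mk_le_norm).trans_lt hst

/-! ### Mollification and density of smooth functions -/

/-- Mollification of a function on the circle. -/
noncomputable def mollify (b : ContDiffBump (0 : ℝ)) (φ : Torus → ℝ) : ℝ → ℝ :=
  convolution (b.normed volume) (fun t : ℝ => φ (t : Torus)) (ContinuousLinearMap.lsmul ℝ ℝ) volume

theorem mollify_periodic (b : ContDiffBump (0 : ℝ)) (φ : Torus → ℝ) :
    Function.Periodic (mollify b φ) 1 := by
  intro t
  simp only [mollify, convolution_def]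
  congr 1
  funext s
  have : ((t + 1 - s : ℝ) : Torus) = ((t - s : ℝ) : Torus) := by
    rw [show t + 1 - s = (t - s) + 1 by ring, AddCircle.coe_add, AddCircle.coe_period, add_zero]
  rw [this]

theorem mollify_contDiff (b : ContDiffBump (0 : ℝ)) {φ : Torus → ℝ} (hφ : Continuous φ) :
    ContDiff ℝ ∞ (mollify b φ) :=
  b.hasCompactSupport_normed.contDiff_convolution_left _ (n := ⊤) b.contDiff_normed
    (continuous_lift hφ).locallyIntegrable

/-- The derivative is put on `φ` rather than on the bump, so that the sup-norm approximation
estimate applies to the derivative as well. -/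
theorem mollify_deriv (b : ContDiffBump (0 : ℝ)) {φ : Torus → ℝ} (hφ : IsSmoothFun 1 φ) (t : ℝ) :
    HasDerivAt (mollify b φ) (mollify b (torusDeriv φ) t) t := by
  have hc := continuous_lift hφ.continuous
  have hc' := continuous_lift hφ.continuous_torusDeriv
  have hs := b.hasCompactSupport_normed (μ := volume)
  obtain ⟨C, -, hC⟩ := exists_bound_torus hφ.continuous_torusDeriv
  have hb : Continuous (b.normed volume) := (b.contDiff_normed (n := 0)).continuous
  have hbi : Integrable (b.normed volume) := hb.integrable_of_hasCompactSupport hs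
  simp only [mollify, convolution_def, ContinuousLinearMap.lsmul_apply, smul_eq_mul]
  refine (hasDerivAt_integral_of_dominated_loc_of_deriv_le (s := univ)
    (F := fun t s => b.normed volume s * φ ((t - s : ℝ) : Torus))
    (F' := fun t s => b.normed volume s * torusDeriv φ ((t - s : ℝ) : Torus))
    (bound := fun s => ‖b.normed volume s‖ * C) univ_mem ?_ ?_ ?_ ?_ ?_ ?_).2
  · refine Eventually.of_forall fun t => Continuous.aestronglyMeasurable ?_
    exact hb.mul (hc.comp (continuous_const.sub continuous_id))
  · refine Continuous.integrable_of_hasCompactSupport ?_ ?_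
    · exact hb.mul (hc.comp (continuous_const.sub continuous_id))
    · exact hs.mul_right
  · exact Continuous.aestronglyMeasurable (hb.mul (hc'.comp (continuous_const.sub continuous_id)))
  · refine Eventually.of_forall fun s t _ => ?_
    rw [norm_mul]
    exact mul_le_mul_of_nonneg_left (hC _) (norm_nonneg _)
  · exact hbi.norm.mul_const C
  · refine Eventually.of_forall fun s t _ => ?_
    have h1 := (hφ.hasDerivAt (t - s)).comp t ((hasDerivAt_id t).sub_const s)
    simpa using h1.const_mul (b.normed volume s)

theorem mollify_dist (b : ContDiffBump (0 : ℝ)) {φ : Torus → ℝ} (hφ : Continuous φ) {ε : ℝ}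
    (h : ∀ s t : ℝ, |s - t| < b.rOut → |φ (s : Torus) - φ (t : Torus)| < ε) (t : ℝ) :
    |mollify b φ t - φ t| ≤ ε :=
  ContDiffBump.dist_normed_convolution_le (continuous_lift hφ).aestronglyMeasurable
    fun x hx => (h x t hx).le

/-- Smooth functions are dense in the continuous functions. -/
theorem exists_smooth_approx {φ : Torus → ℝ} (hφ : Continuous φ) {ε : ℝ} (hε : 0 < ε) :
    ∃ ψ : Torus → ℝ, IsSmoothFun ⊤ ψ ∧ ∀ x, |ψ x - φ x| ≤ ε := by
  obtain ⟨r, hr, h⟩ := exists_delta_lift hφ hε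
  let b : ContDiffBump (0 : ℝ) := ⟨r / 2, r, half_pos hr, half_lt_self hr⟩
  refine ⟨(mollify_periodic b φ).lift, mollify_contDiff b hφ, fun x => ?_⟩
  obtain ⟨t, rfl⟩ := torus_surj x
  exact mollify_dist b hφ h t

/-- Smooth functions are dense in `C¹`. -/
theorem exists_smooth_approx_one {φ : Torus → ℝ} (hφ : IsSmoothFun 1 φ) {ε : ℝ} (hε : 0 < ε) :
    ∃ ψ : Torus → ℝ, IsSmoothFun ⊤ ψ ∧ (∀ x, |ψ x - φ x| ≤ ε) ∧
      ∀ x, |torusDeriv ψ x - torusDeriv φ x| ≤ ε := by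
  obtain ⟨r, hr, h⟩ := exists_delta_lift hφ.continuous hε
  obtain ⟨r', hr', h'⟩ := exists_delta_lift hφ.continuous_torusDeriv hε
  have hm : 0 < min r r' := lt_min hr hr'
  let b : ContDiffBump (0 : ℝ) := ⟨min r r' / 2, min r r', half_pos hm, half_lt_self hm⟩
  refine ⟨(mollify_periodic b φ).lift, mollify_contDiff b hφ.continuous, fun x => ?_, fun x => ?_⟩
  · obtain ⟨t, rfl⟩ := torus_surj x
    exact mollify_dist b hφ.continuous (fun s t hst => h s t (hst.trans_le (min_le_left _ _))) t
  · obtain ⟨t, rfl⟩ := torus_surj x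
    have : torusDeriv (mollify_periodic b φ).lift (t : Torus) = mollify b (torusDeriv φ) t := by
      rw [torusDeriv_coe]
      exact (mollify_deriv b hφ t).deriv
    rw [this]
    exact mollify_dist b hφ.continuous_torusDeriv
      (fun s t hst => h' s t (hst.trans_le (min_le_right _ _))) t

theorem abs_integral_mul_le {f φ : Torus → ℝ} (hf : Integrable f volume) {C : ℝ}
    (h : ∀ x, |φ x| ≤ C) : |∫ x, f x * φ x| ≤ (∫ x, |f x|) * C := by
  rw [← integral_mul_const, ← Real.norm_eq_abs]
  refine norm_integral_le_of_norm_le (hf.abs.mul_const C) (Eventually.of_forall fun x => ?_)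
  rw [norm_mul]
  exact mul_le_mul_of_nonneg_left (h x) (abs_nonneg _)

/-- Weak derivatives can be tested against `C¹` functions. -/
theorem HasWeakDeriv.integral_mul_torusDeriv {f g φ : Torus → ℝ} (h : HasWeakDeriv f g)
    (hφ : IsSmoothFun 1 φ) : ∫ x, f x * torusDeriv φ x = -∫ x, g x * φ x := by
  obtain ⟨hf, hg, hw⟩ := h
  rw [← sub_eq_zero, ← abs_eq_zero]
  refine le_antisymm (le_of_forall_pos_le_add fun ε hε => ?_) (abs_nonneg _)
  have hK : 0 ≤ (∫ x, |f x|) + ∫ x, |g x| := by positivity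
  set K := (∫ x, |f x|) + ∫ x, |g x|
  -- Dividing by `K + 1` instead of `K` covers the case `K = 0`.
  obtain ⟨ψ, hψ, h0, h1⟩ := exists_smooth_approx_one hφ (ε := ε / (K + 1)) (by positivity)
  have hψ1 : IsSmoothFun 1 ψ := hψ.of_le le_top
  have e := hw ψ hψ
  have i1 := hφ.continuous_torusDeriv.integrable_mul_torus hf
  have i2 := hψ1.continuous_torusDeriv.integrable_mul_torus hf
  have i3 := hφ.continuous.integrable_mul_torus hg
  have i4 := hψ1.continuous.integrable_mul_torus hg
  have e1 := abs_integral_mul_le hf h1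
  have e2 := abs_integral_mul_le hg h0
  simp only [mul_sub] at e1 e2
  rw [integral_sub i2 i1, e] at e1
  rw [integral_sub i4 i3] at e2
  have e3 : (∫ x, |f x|) * (ε / (K + 1)) + (∫ x, |g x|) * (ε / (K + 1)) ≤ ε := by
    rw [← add_mul, mul_div_assoc', div_le_iff₀ (by positivity)]
    change K * ε ≤ _
    nlinarith
  rw [abs_le] at e1 e2 ⊢
  constructor <;> linarith [e1.1, e1.2, e2.1, e2.2]

/-! ### Duality and uniqueness of weak derivatives -/

/-- Duality for the `L¹` norm. -/
theorem integral_abs_le_of_dual {g : Torus → ℝ} (hg : Integrable g volume) {M : ℝ}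
    (h : ∀ φ : Torus → ℝ, Continuous φ → (∀ x, |φ x| ≤ 1) → ∫ x, g x * φ x ≤ M) :
    ∫ x, |g x| ≤ M := by
  -- The optimal test function is the sign of `g`. It is approximated in `L¹` by continuous
  -- functions, almost everywhere along a subsequence; dominated convergence then passes to the
  -- limit.
  set s : Torus → ℝ := fun x => SignType.sign (g x) with hs
  have hsm : AEStronglyMeasurable s volume := by
    have h1 : Measurable fun y : ℝ => ((SignType.sign y : SignType) : ℝ) := by
      simp only [sign_apply]
      refine Measurable.comp (g := fun z : SignType => (z : ℝ)) (measurable_from_top) ?_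
      exact Measurable.ite measurableSet_Ioi measurable_const
        (Measurable.ite measurableSet_Iio measurable_const measurable_const)
    exact (h1.comp_aemeasurable hg.aemeasurable).aestronglyMeasurable
  have hs1 : ∀ x, |s x| ≤ 1 := fun x => by
    simp only [hs]
    rcases SignType.sign (g x) with _ | _ | _ <;> simp
  have hsi : Integrable s volume :=
    Integrable.of_bound hsm 1 (Eventually.of_forall hs1)
  choose φ hφ _ using fun n : ℕ => hsi.exists_boundedContinuous_integral_sub_le
    (ε := 1 / ((n : ℝ) + 1)) (by positivity)
  have hten : Tendsto (fun n => eLpNorm ((fun x => φ n x) - s) 1 volume) atTop (𝓝 0) := by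
    have h1 : ∀ n, eLpNorm ((fun x => φ n x) - s) 1 volume ≤ ENNReal.ofReal (1 / ((n : ℝ) + 1)) := by
      intro n
      rw [eLpNorm_one_eq_lintegral_enorm, ← ofReal_integral_norm_eq_lintegral_enorm]
      · refine ENNReal.ofReal_le_ofReal (le_trans (le_of_eq ?_) (hφ n))
        exact integral_congr_ae (Eventually.of_forall fun x => norm_sub_rev _ _)
      · exact ((φ n).integrable _).sub hsi
    refine tendsto_of_tendsto_of_tendsto_of_le_of_le tendsto_const_nhds ?_ (fun _ => zero_le) h1
    rw [← ENNReal.ofReal_zero]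
    exact ENNReal.tendsto_ofReal tendsto_one_div_add_atTop_nhds_zero_nat
  obtain ⟨ns, -, hns⟩ := (tendstoInMeasure_of_tendsto_eLpNorm one_ne_zero
    (fun n => (φ n).continuous.aestronglyMeasurable) hsm hten).exists_seq_tendsto_ae
  -- Clamping to `[-1, 1]` makes the approximants admissible test functions and leaves the sign
  -- function unchanged.
  let c : ℝ → ℝ := fun y => max (-1) (min 1 y)
  have hc : Continuous c := by fun_prop
  have hc1 : ∀ y, |c y| ≤ 1 := fun y => by
    rw [abs_le]
    exact ⟨le_max_left _ _, max_le (by norm_num) (min_le_left _ _)⟩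
  have hcs : ∀ x, c (s x) = s x := fun x => by
    have := abs_le.1 (hs1 x)
    simp only [c]
    rw [min_eq_right this.2, max_eq_right this.1]
  have hlim : Tendsto (fun i => ∫ x, g x * c (φ (ns i) x)) atTop (𝓝 (∫ x, g x * s x)) := by
    refine tendsto_integral_of_dominated_convergence (fun x => |g x|) (fun i => ?_) hg.abs
      (fun i => Eventually.of_forall fun x => ?_) ?_
    · exact hg.aestronglyMeasurable.mul
        (hc.comp (φ (ns i)).continuous).aestronglyMeasurable
    · rw [norm_mul]
      exact mul_le_of_le_one_right (abs_nonneg _) (hc1 _)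
    · filter_upwards [hns] with x hx
      have := (hc.tendsto (s x)).comp hx
      rw [hcs] at this
      exact this.const_mul _
  have : ∫ x, |g x| = ∫ x, g x * s x := by
    congr 1; funext x; simp only [hs]; rw [mul_comm, sign_mul_self]
  rw [this]
  exact le_of_tendsto' hlim fun i => h _ (hc.comp (φ (ns i)).continuous) fun x => hc1 _

/-- A function orthogonal to all smooth functions vanishes. -/
theorem integral_abs_eq_zero_of_smooth {g : Torus → ℝ} (hg : Integrable g volume)
    (h : ∀ φ : Torus → ℝ, IsSmoothFun ⊤ φ → ∫ x, g x * φ x = 0) : ∫ x, |g x| = 0 := by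
  refine le_antisymm (integral_abs_le_of_dual hg fun φ hφ _ => ?_) (by positivity)
  refine le_of_forall_pos_le_add fun ε hε => ?_
  have hK : 0 ≤ ∫ x, |g x| := by positivity
  set K := ∫ x, |g x| with hKdef
  obtain ⟨ψ, hψ, h0⟩ := exists_smooth_approx hφ (ε := ε / (K + 1)) (by positivity)
  have e2 := abs_integral_mul_le hg h0
  simp only [mul_sub] at e2
  rw [integral_sub (hψ.continuous.integrable_mul_torus hg) (hφ.integrable_mul_torus hg),
    h ψ hψ, ← hKdef] at e2
  have : K * (ε / (K + 1)) ≤ ε := by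
    rw [mul_div_assoc', div_le_iff₀ (by positivity)]
    nlinarith
  linarith [(abs_le.1 e2).1]

theorem ae_eq_zero_of_smooth {g : Torus → ℝ} (hg : Integrable g volume)
    (h : ∀ φ : Torus → ℝ, IsSmoothFun ⊤ φ → ∫ x, g x * φ x = 0) : g =ᵐ[volume] 0 := by
  have h0 := (integral_eq_zero_iff_of_nonneg (fun x => abs_nonneg (g x)) hg.abs).1
    (integral_abs_eq_zero_of_smooth hg h)
  filter_upwards [h0] with x hx
  simpa using hx

theorem HasWeakDeriv.unique {f g g' : Torus → ℝ} (h : HasWeakDeriv f g) (h' : HasWeakDeriv f g') :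
    g =ᵐ[volume] g' := by
  have := ae_eq_zero_of_smooth (g := fun x => g x - g' x) (h.2.1.sub h'.2.1) fun φ hφ => by
    simp only [sub_mul]
    rw [integral_sub (hφ.continuous.integrable_mul_torus h.2.1)
      (hφ.continuous.integrable_mul_torus h'.2.1)]
    linarith [h.2.2 φ hφ, h'.2.2 φ hφ]
  filter_upwards [this] with x hx
  exact sub_eq_zero.1 hx

/-- Removes the arbitrary choice in `weakDeriv`: all weak derivatives agree almost everywhere. -/
theorem HasWeakDeriv.sobolevNorm_eq {f g : Torus → ℝ} (h : HasWeakDeriv f g) :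
    sobolevNorm f = (∫ x, |f x|) + ∫ x, |g x| := by
  have h' : HasWeakDeriv f (weakDeriv f) := Classical.epsilon_spec ⟨g, h⟩
  unfold sobolevNorm
  congr 1
  refine integral_congr_ae ?_
  filter_upwards [h'.unique h] with x hx
  rw [hx]

theorem HasWeakDeriv.add {f g f' g' : Torus → ℝ} (h : HasWeakDeriv f g)
    (h' : HasWeakDeriv f' g') :
    HasWeakDeriv (fun x => f x + f' x) (fun x => g x + g' x) := by
  refine ⟨h.1.add h'.1, h.2.1.add h'.2.1, fun φ hφ => ?_⟩
  have hφ1 : IsSmoothFun 1 φ := hφ.of_le le_top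
  simp only [add_mul]
  rw [integral_add (hφ1.continuous_torusDeriv.integrable_mul_torus h.1)
    (hφ1.continuous_torusDeriv.integrable_mul_torus h'.1),
    integral_add (hφ.continuous.integrable_mul_torus h.2.1)
    (hφ.continuous.integrable_mul_torus h'.2.1), h.2.2 φ hφ, h'.2.2 φ hφ]
  ring

theorem HasWeakDeriv.sub {f g f' g' : Torus → ℝ} (h : HasWeakDeriv f g)
    (h' : HasWeakDeriv f' g') :
    HasWeakDeriv (fun x => f x - f' x) (fun x => g x - g' x) := by
  refine ⟨h.1.sub h'.1, h.2.1.sub h'.2.1, fun φ hφ => ?_⟩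
  have hφ1 : IsSmoothFun 1 φ := hφ.of_le le_top
  simp only [sub_mul]
  rw [integral_sub (hφ1.continuous_torusDeriv.integrable_mul_torus h.1)
    (hφ1.continuous_torusDeriv.integrable_mul_torus h'.1),
    integral_sub (hφ.continuous.integrable_mul_torus h.2.1)
    (hφ.continuous.integrable_mul_torus h'.2.1), h.2.2 φ hφ, h'.2.2 φ hφ]
  ring

theorem HasWeakDeriv.congr {f g f' g' : Torus → ℝ} (h : HasWeakDeriv f g)
    (hf : f =ᵐ[volume] f') (hg : g =ᵐ[volume] g') : HasWeakDeriv f' g' := by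
  refine ⟨h.1.congr hf, h.2.1.congr hg, fun φ hφ => ?_⟩
  have h1 : ∫ x, f' x * torusDeriv φ x = ∫ x, f x * torusDeriv φ x :=
    integral_congr_ae (by filter_upwards [hf] with x hx; rw [hx])
  have h2 : ∫ x, g' x * φ x = ∫ x, g x * φ x :=
    integral_congr_ae (by filter_upwards [hg] with x hx; rw [hx])
  rw [h1, h2, h.2.2 φ hφ]

/-- Leibniz rule with a `C¹` factor. -/
theorem HasWeakDeriv.mul_smooth {f g w : Torus → ℝ} (h : HasWeakDeriv f g)
    (hw : IsSmoothFun 1 w) :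
    HasWeakDeriv (fun x => f x * w x) (fun x => g x * w x + f x * torusDeriv w x) := by
  have i1 := hw.continuous.integrable_mul_torus h.1
  have i2 := hw.continuous.integrable_mul_torus h.2.1
  have i3 := hw.continuous_torusDeriv.integrable_mul_torus h.1
  refine ⟨i1, i2.add i3, fun φ hφ => ?_⟩
  have hφ1 : IsSmoothFun 1 φ := hφ.of_le le_top
  obtain ⟨hs, hd⟩ := isSmoothFun_one_of_hasDerivAt (φ := fun x => w x * φ x)
    (ψ := fun x => torusDeriv w x * φ x + w x * torusDeriv φ x)
    ((hw.continuous_torusDeriv.mul hφ.continuous).add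
      (hw.continuous.mul hφ1.continuous_torusDeriv))
    (fun t => (hw.hasDerivAt t).mul (hφ1.hasDerivAt t))
  have e := h.integral_mul_torusDeriv hs
  rw [hd] at e
  have j1 := hφ.continuous.integrable_mul_torus i2
  have j2 := hφ.continuous.integrable_mul_torus i3
  have j3 := hφ1.continuous_torusDeriv.integrable_mul_torus i1
  simp only [mul_add, add_mul, ← mul_assoc] at e ⊢
  rw [integral_add j2 j3] at e
  rw [integral_add j1 j2]
  linarith


/-! ### Poincaré inequality and translations -/

theorem abs_integral_le_of_bound {φ : Torus → ℝ} (h : ∀ x, |φ x| ≤ 1) : |∫ x, φ x| ≤ 1 := by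
  have := norm_integral_le_of_norm_le_const (μ := (volume : Measure Torus))
    (f := φ) (C := 1) (Eventually.of_forall h)
  simpa using this

/-- By duality: subtracting its mean `c` from a test function `φ` does not change the pairing with
the mean-zero `u`, and `φ - c` has a periodic primitive bounded by `2`. Integration by parts moves
the pairing onto `v`. -/
theorem poincare {u v : Torus → ℝ} (h : HasWeakDeriv u v) (h0 : ∫ x, u x = 0) :
    ∫ x, |u x| ≤ 2 * ∫ x, |v x| := by
  refine integral_abs_le_of_dual h.1 fun φ hφ hφ1 => ?_
  set c := ∫ x, φ x with hc
  have hc1 : |c| ≤ 1 := abs_integral_le_of_bound hφ1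
  have hcont : Continuous fun t : ℝ => φ (t : Torus) - c := (continuous_lift hφ).sub continuous_const
  have hii : ∀ s t, IntervalIntegrable (fun t : ℝ => φ (t : Torus) - c) volume s t :=
    fun s t => hcont.intervalIntegrable s t
  have hper : Function.Periodic (fun t : ℝ => ∫ s in (0 : ℝ)..t, (φ (s : Torus) - c)) 1 := by
    intro t
    have h1 := UnitAddCircle.intervalIntegral_preimage t (fun x => φ x - c)
    rw [integral_sub (hφ.integrable_of_hasCompactSupport
      (HasCompactSupport.of_compactSpace φ)) (integrable_const c)] at h1
    have h2 := intervalIntegral.integral_add_adjacent_intervals (hii 0 t) (hii t (t + 1))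
    simp only [integral_const, probReal_univ, one_smul, ← hc, sub_self] at h1
    simp only
    linarith
  have hbd : ∀ x, |hper.lift x| ≤ 2 := by
    intro x
    obtain ⟨t, rfl⟩ := torus_surj x
    -- Periodicity reduces to an interval of length at most one, where the integrand is bounded by
    -- `2`.
    obtain ⟨s, hs, hst⟩ := hper.exists_mem_Ico₀ one_pos t
    rw [hper.lift_coe, hst]
    have := intervalIntegral.norm_integral_le_of_norm_le_const (a := 0) (b := s) (C := 2)
      (f := fun t : ℝ => φ (t : Torus) - c) fun t _ =>
        (abs_sub _ _).trans (by linarith [hφ1 (t : Torus)])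
    rw [Real.norm_eq_abs, sub_zero, abs_of_nonneg hs.1] at this
    linarith [hs.2]
  obtain ⟨hs, hd⟩ := isSmoothFun_one_of_hasDerivAt (φ := hper.lift) (ψ := fun x => φ x - c)
    (hφ.sub continuous_const) fun t =>
      intervalIntegral.integral_hasDerivAt_right (hii 0 t)
        hcont.aestronglyMeasurable.stronglyMeasurableAtFilter hcont.continuousAt
  have e := h.integral_mul_torusDeriv hs
  rw [hd] at e
  simp only [mul_sub] at e
  rw [integral_sub (hφ.integrable_mul_torus h.1) (h.1.mul_const c), integral_mul_const, h0] at e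
  have := abs_le.1 (abs_integral_mul_le h.2.1 hbd)
  linarith [this.1]

/-- Translation of a function on the circle. -/
noncomputable def translate (b : ℝ) (f : Torus → ℝ) (x : Torus) : ℝ := f (x - (b : Torus))

theorem integrable_translate (b : ℝ) {f : Torus → ℝ} (hf : Integrable f volume) :
    Integrable (translate b f) volume :=
  hf.comp_sub_right (b : Torus)

theorem integral_translate (b : ℝ) (f : Torus → ℝ) : ∫ x, translate b f x = ∫ x, f x :=
  integral_sub_right_eq_self f (b : Torus)

theorem integral_abs_translate (b : ℝ) (f : Torus → ℝ) :
    ∫ x, |translate b f x| = ∫ x, |f x| :=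
  integral_translate b fun x => |f x|

theorem integral_translate_mul (b : ℝ) (f φ : Torus → ℝ) :
    ∫ x, translate b f x * φ x = ∫ x, f x * φ (x + (b : Torus)) := by
  rw [← integral_translate b fun x => f x * φ (x + (b : Torus))]
  simp [translate]

theorem ae_translate (b : ℝ) {p : Torus → Prop} (h : ∀ᵐ x, p x) :
    ∀ᵐ x : Torus, p (x - (b : Torus)) :=
  (measurePreserving_sub_right volume (b : Torus)).quasiMeasurePreserving.ae h

theorem IsProbDensity.translate (b : ℝ) {f : Torus → ℝ} (hf : IsProbDensity f) :
    IsProbDensity (translate b f) :=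
  ⟨integrable_translate b hf.1, ae_translate b (p := fun x => 0 ≤ f x) hf.2.1,
    (integral_translate b f).trans hf.2.2⟩

theorem hasDerivAt_comp_add {φ : Torus → ℝ} (hφ : IsSmoothFun 1 φ) (b t : ℝ) :
    HasDerivAt (fun t : ℝ => φ ((t : Torus) + (b : Torus)))
      (torusDeriv φ ((t : Torus) + (b : Torus))) t := by
  have := (hφ.hasDerivAt (t + b)).comp_add_const t b
  simpa only [AddCircle.coe_add] using this

theorem HasWeakDeriv.translate (b : ℝ) {f g : Torus → ℝ} (h : HasWeakDeriv f g) :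
    HasWeakDeriv (translate b f) (translate b g) := by
  refine ⟨integrable_translate b h.1, integrable_translate b h.2.1, fun φ hφ => ?_⟩
  have hφ1 : IsSmoothFun 1 φ := hφ.of_le le_top
  obtain ⟨hs, hd⟩ := isSmoothFun_one_of_hasDerivAt (φ := fun x => φ (x + (b : Torus)))
    (ψ := fun x => torusDeriv φ (x + (b : Torus)))
    (hφ1.continuous_torusDeriv.comp (continuous_add_const _)) (hasDerivAt_comp_add hφ1 b)
  have e := h.integral_mul_torusDeriv hs
  rw [hd] at e
  rw [integral_translate_mul, integral_translate_mul, e]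

/-- Dually, the translations fall on the test function, and `φ (x + b) - φ (x + a)` is the
derivative of the periodic function `∫ φ` over `[x + a, x + b]`, which is bounded by `|b - a|`. -/
theorem integral_abs_translate_sub_le {u v : Torus → ℝ} (h : HasWeakDeriv u v) (a b : ℝ) :
    ∫ x, |translate b u x - translate a u x| ≤ |b - a| * ∫ x, |v x| := by
  refine integral_abs_le_of_dual (g := fun x => translate b u x - translate a u x)
    ((integrable_translate b h.1).sub (integrable_translate a h.1)) fun φ hφ hφ1 => ?_
  have hcont := continuous_lift hφ
  have hii : ∀ s t, IntervalIntegrable (fun t : ℝ => φ (t : Torus)) volume s t :=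
    fun s t => hcont.intervalIntegrable s t
  have hsub : ∀ t : ℝ, (∫ s in (0 : ℝ)..(t + b), φ (s : Torus)) -
      (∫ s in (0 : ℝ)..(t + a), φ (s : Torus)) = ∫ s in (t + a)..(t + b), φ (s : Torus) :=
    fun t => intervalIntegral.integral_interval_sub_left (hii _ _) (hii _ _)
  have hper : Function.Periodic (fun t : ℝ => (∫ s in (0 : ℝ)..(t + b), φ (s : Torus)) -
      ∫ s in (0 : ℝ)..(t + a), φ (s : Torus)) 1 := by
    intro t
    simp only
    rw [hsub, hsub, show t + 1 + a = t + a + 1 by ring, show t + 1 + b = t + b + 1 by ring,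
      ← intervalIntegral.integral_comp_add_right]
    congr 1
    funext s
    rw [AddCircle.coe_add, AddCircle.coe_period, add_zero]
  have hbd : ∀ x, |hper.lift x| ≤ |b - a| := by
    intro x
    obtain ⟨t, rfl⟩ := torus_surj x
    rw [hper.lift_coe, hsub]
    have := intervalIntegral.norm_integral_le_of_norm_le_const (a := t + a) (b := t + b) (C := 1)
      (f := fun t : ℝ => φ (t : Torus)) fun t _ => hφ1 _
    rwa [one_mul, add_sub_add_left_eq_sub] at this
  have hF : ∀ t c : ℝ, HasDerivAt (fun t : ℝ => ∫ s in (0 : ℝ)..(t + c), φ (s : Torus))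
      (φ ((t : Torus) + (c : Torus))) t := fun t c =>
    HasDerivAt.comp_add_const (f := fun t : ℝ => ∫ s in (0 : ℝ)..t, φ (s : Torus)) t c
      (intervalIntegral.integral_hasDerivAt_right (hii 0 (t + c))
        hcont.aestronglyMeasurable.stronglyMeasurableAtFilter hcont.continuousAt)
  have hcb : Continuous fun x => φ (x + (b : Torus)) := hφ.comp (continuous_add_const _)
  have hca : Continuous fun x => φ (x + (a : Torus)) := hφ.comp (continuous_add_const _)
  obtain ⟨hs, hd⟩ := isSmoothFun_one_of_hasDerivAt (φ := hper.lift)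
    (ψ := fun x => φ (x + (b : Torus)) - φ (x + (a : Torus))) (hcb.sub hca)
    fun t => (hF t b).sub (hF t a)
  have e := h.integral_mul_torusDeriv hs
  rw [hd] at e
  simp only [mul_sub, sub_mul] at e ⊢
  rw [integral_sub (hcb.integrable_mul_torus h.1) (hca.integrable_mul_torus h.1)] at e
  rw [integral_sub (hφ.integrable_mul_torus (integrable_translate b h.1))
    (hφ.integrable_mul_torus (integrable_translate a h.1)), integral_translate_mul,
    integral_translate_mul, e]
  have := abs_le.1 (abs_integral_mul_le h.2.1 hbd)
  linarith [this.1]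

/-! ### Push-forward of densities -/

/-- `p` is the density of the push-forward under `T` of the (signed) density `f`. -/
def IsPush (T : Torus → Torus) (f p : Torus → ℝ) : Prop :=
  Integrable f volume ∧ Integrable p volume ∧
    ∀ φ : Torus → ℝ, Continuous φ → ∫ x, p x * φ x = ∫ x, f x * φ (T x)

/-- `T` has a `C¹` lift whose derivative is `1 / w`, with `w > 0`. -/
def HasInvDeriv (T : Torus → Torus) (w : Torus → ℝ) : Prop :=
  (∀ x, 0 < w x) ∧ ∃ F : ℝ → ℝ, (∀ t : ℝ, T t = (F t : Torus)) ∧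
    ∀ t : ℝ, HasDerivAt F (w t)⁻¹ t

theorem HasInvDeriv.continuous {T : Torus → Torus} {w : Torus → ℝ} (h : HasInvDeriv T w) :
    Continuous T := by
  obtain ⟨-, F, hF, hd⟩ := h
  refine (QuotientAddGroup.isQuotientMap_mk (AddSubgroup.zmultiples (1 : ℝ))).continuous_iff.2 ?_
  have hc : Continuous F := continuous_iff_continuousAt.2 fun t => (hd t).continuousAt
  exact ((AddCircle.continuous_mk' 1).comp hc).congr fun t => (hF t).symm

theorem volume_preimage_coe_eq_zero {N : Set Torus} (hN : MeasurableSet N) (h : volume N = 0) :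
    volume ((fun t : ℝ => (t : Torus)) ⁻¹' N) = 0 := by
  refine measure_null_of_locally_null _ fun t _ => ?_
  -- A fundamental domain centred at `t`, hence a neighbourhood of `t`.
  refine ⟨(fun t : ℝ => (t : Torus)) ⁻¹' N ∩ Ioc (t - 1 / 2) (t - 1 / 2 + 1), ?_, ?_⟩
  · exact inter_mem self_mem_nhdsWithin
      (mem_nhdsWithin_of_mem_nhds (Ioc_mem_nhds (by linarith) (by linarith)))
  · have := (AddCircle.measurePreserving_mk 1 (t - 1 / 2)).measure_preimage hN.nullMeasurableSet
    rw [h, Measure.restrict_apply' measurableSet_Ioc] at this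
    exact this

/-- The lift is injective with positive derivative. Change of variables on one period shows that the
indicator of a null set, composed with the lift and weighted by that derivative, has integral zero;
positivity of the weight makes the preimage null. -/
theorem HasInvDeriv.map_absolutelyContinuous {T : Torus → Torus} {w : Torus → ℝ}
    (h : HasInvDeriv T w) : (volume : Measure Torus).map T ≪ volume := by
  have hT := h.continuous.measurable
  obtain ⟨hw, F, hF, hd⟩ := h
  refine Measure.AbsolutelyContinuous.mk fun N hN h0 => ?_
  rw [Measure.map_apply hT hN,
    ← (AddCircle.measurePreserving_mk 1 0).measure_preimage (hT hN).nullMeasurableSet]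
  set A : Set ℝ := (fun t : ℝ => (t : Torus)) ⁻¹' N with hA
  have hAm : MeasurableSet A := AddCircle.measurable_mk' hN
  have hA0 : volume A = 0 := volume_preimage_coe_eq_zero hN h0
  have hmono : StrictMono F := strictMono_of_deriv_pos fun t => by
    rw [(hd t).deriv]; exact inv_pos.2 (hw _)
  have hc : Continuous F := continuous_iff_continuousAt.2 fun t => (hd t).continuousAt
  have hwm : Measurable fun t : ℝ => (w (t : Torus))⁻¹ := by
    rw [show (fun t : ℝ => (w (t : Torus))⁻¹) = deriv F from funext fun t => (hd t).deriv.symm]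
    exact measurable_deriv F
  have key := lintegral_image_eq_lintegral_abs_deriv_mul (s := Ioc 0 (0 + 1))
    (f := F) (f' := fun t => (w (t : Torus))⁻¹) measurableSet_Ioc
    (fun t _ => (hd t).hasDerivWithinAt) (hmono.injective.injOn) (A.indicator 1)
  have hz : ∫⁻ x in F '' Ioc 0 (0 + 1), A.indicator 1 x = 0 := by
    refine le_antisymm ((setLIntegral_le_lintegral _ _).trans ?_) zero_le
    rw [lintegral_indicator_one hAm, hA0]
  have hm : Measurable fun t : ℝ => ENNReal.ofReal |(w (t : Torus))⁻¹| * A.indicator 1 (F t) :=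
    Measurable.mul hwm.abs.ennreal_ofReal
      (Measurable.comp (g := A.indicator 1) (measurable_one.indicator hAm) hc.measurable)
  rw [hz, eq_comm, lintegral_eq_zero_iff hm] at key
  have hsub : QuotientAddGroup.mk ⁻¹' (T ⁻¹' N) = F ⁻¹' A := by
    ext t
    change T (t : Torus) ∈ N ↔ ((F t : ℝ) : Torus) ∈ N
    rw [hF]
  refine (congrArg _ hsub).trans (measure_mono_null ?_ (ae_iff.1 key))
  intro t ht
  simp only [Pi.zero_apply, mem_ofPred_eq, mul_eq_zero, not_or, ENNReal.ofReal_eq_zero, not_le]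
  refine ⟨abs_pos.2 (inv_pos.2 (hw _)).ne', ?_⟩
  rw [indicator_of_mem (show F t ∈ A from ht)]
  simp

/-! ### Measures with densities and their images -/

theorem integral_densityMeasure {f : Torus → ℝ} (hf : Integrable f volume) (h0 : ∀ᵐ x, 0 ≤ f x)
    (φ : Torus → ℝ) : ∫ x, φ x ∂densityMeasure f = ∫ x, f x * φ x := by
  unfold densityMeasure
  rw [integral_withDensity_eq_integral_toReal_smul₀ hf.aemeasurable.ennreal_ofReal
    (Eventually.of_forall fun _ => ENNReal.ofReal_lt_top)]
  refine integral_congr_ae ?_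
  filter_upwards [h0] with x hx
  rw [ENNReal.toReal_ofReal hx, smul_eq_mul]

theorem isFiniteMeasure_densityMeasure {f : Torus → ℝ} (hf : Integrable f volume) :
    IsFiniteMeasure (densityMeasure f) :=
  isFiniteMeasure_withDensity_ofReal hf.2

theorem densityMeasure_map_translate {f : Torus → ℝ} (hf : IsProbDensity f) (b : ℝ) :
    (densityMeasure f).map (fun x => x + (b : Torus)) = densityMeasure (translate b f) := by
  have := isFiniteMeasure_densityMeasure hf.1
  have := isFiniteMeasure_densityMeasure (hf.translate b).1
  have : IsFiniteMeasure ((densityMeasure f).map (fun x => x + (b : Torus))) := inferInstance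
  refine ext_of_forall_integral_eq_of_IsFiniteMeasure fun φ => ?_
  rw [integral_map (measurable_add_const _).aemeasurable φ.continuous.aestronglyMeasurable,
    integral_densityMeasure hf.1 hf.2.1, integral_densityMeasure (hf.translate b).1
    (hf.translate b).2.1, integral_translate_mul]

theorem isPush_of_map_eq {T : Torus → Torus} (hT : Continuous T) {f p : Torus → ℝ}
    (hf : Integrable f volume) (hf0 : ∀ᵐ x, 0 ≤ f x) (hp : Integrable p volume)
    (hp0 : ∀ᵐ x, 0 ≤ p x) (h : (densityMeasure f).map T = densityMeasure p) : IsPush T f p := by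
  refine ⟨hf, hp, fun φ hφ => ?_⟩
  rw [← integral_densityMeasure hp hp0, ← h, integral_map hT.measurable.aemeasurable
    hφ.aestronglyMeasurable, integral_densityMeasure hf hf0]

theorem HasInvDeriv.exists_map_eq {T : Torus → Torus} {w : Torus → ℝ} (h : HasInvDeriv T w)
    {f : Torus → ℝ} (hf : Integrable f volume) :
    ∃ p : Torus → ℝ, Integrable p volume ∧ (∀ x, 0 ≤ p x) ∧
      (densityMeasure f).map T = densityMeasure p := by
  have := isFiniteMeasure_densityMeasure hf
  have hac : (densityMeasure f).map T ≪ volume :=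
    ((withDensity_absolutelyContinuous _ _).map h.continuous.measurable).trans
      h.map_absolutelyContinuous
  refine ⟨fun x => (((densityMeasure f).map T).rnDeriv volume x).toReal,
    Measure.integrable_toReal_rnDeriv, fun x => ENNReal.toReal_nonneg, ?_⟩
  conv_lhs => rw [← Measure.withDensity_rnDeriv_eq _ _ hac]
  refine withDensity_congr_ae ?_
  filter_upwards [Measure.rnDeriv_lt_top ((densityMeasure f).map T) volume] with x hx
  rw [ENNReal.ofReal_toReal hx.ne]

theorem IsPush.sub {T : Torus → Torus} (hT : Continuous T) {f p f' p' : Torus → ℝ}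
    (h : IsPush T f p) (h' : IsPush T f' p') :
    IsPush T (fun x => f x - f' x) (fun x => p x - p' x) := by
  refine ⟨h.1.sub h'.1, h.2.1.sub h'.2.1, fun φ hφ => ?_⟩
  have hφT : Continuous fun x => φ (T x) := hφ.comp hT
  simp only [sub_mul]
  rw [integral_sub (hφ.integrable_mul_torus h.2.1) (hφ.integrable_mul_torus h'.2.1),
    integral_sub (hφT.integrable_mul_torus h.1) (hφT.integrable_mul_torus h'.1),
    h.2.2 φ hφ, h'.2.2 φ hφ]

/-- Signed densities are needed for derivatives and differences; the positive and negative parts are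
pushed separately. -/
theorem HasInvDeriv.exists_isPush {T : Torus → Torus} {w : Torus → ℝ} (h : HasInvDeriv T w)
    {f : Torus → ℝ} (hf : Integrable f volume) : ∃ p, IsPush T f p := by
  have hp := hf.pos_part
  have hn := hf.neg_part
  obtain ⟨p, hp1, hp2, hp3⟩ := h.exists_map_eq hp
  obtain ⟨q, hq1, hq2, hq3⟩ := h.exists_map_eq hn
  have := (isPush_of_map_eq h.continuous hp (Eventually.of_forall fun x => le_max_right _ _) hp1
    (Eventually.of_forall hp2) hp3).sub h.continuous
    (isPush_of_map_eq h.continuous hn (Eventually.of_forall fun x => le_max_right _ _) hq1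
    (Eventually.of_forall hq2) hq3)
  refine ⟨fun x => p x - q x, ?_⟩
  · convert this using 2 with x
    rcases le_total (f x) 0 with h0 | h0
    · rw [max_eq_right h0, max_eq_left (by linarith)]; ring
    · rw [max_eq_left h0, max_eq_right (by linarith)]; ring

theorem IsPush.integral_abs_le {T : Torus → Torus} {f p : Torus → ℝ} (h : IsPush T f p) :
    ∫ x, |p x| ≤ ∫ x, |f x| := by
  refine integral_abs_le_of_dual h.2.1 fun φ hφ hφ1 => ?_
  rw [h.2.2 φ hφ]
  have := abs_integral_mul_le h.1 (φ := fun x => φ (T x)) (C := 1) fun x => hφ1 _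
  rw [mul_one] at this
  exact (le_abs_self _).trans this

theorem IsPush.integral_eq {T : Torus → Torus} {f p : Torus → ℝ} (h : IsPush T f p) :
    ∫ x, p x = ∫ x, f x := by
  simpa using h.2.2 (fun _ => 1) continuous_const

/-- The weak derivative of a push-forward. -/
theorem IsPush.hasWeakDeriv {T : Torus → Torus} {w : Torus → ℝ} (hT : HasInvDeriv T w)
    (hw : IsSmoothFun 1 w) {f g p q : Torus → ℝ} (hfg : HasWeakDeriv f g) (hp : IsPush T f p)
    (hq : IsPush T (fun x => g x * w x + f x * torusDeriv w x) q) : HasWeakDeriv p q := by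
  refine ⟨hp.2.1, hq.2.1, fun φ hφ => ?_⟩
  have hφ1 : IsSmoothFun 1 φ := hφ.of_le le_top
  have hTc := hT.continuous
  obtain ⟨hw0, F, hF, hd⟩ := hT
  -- The chain rule gives `φ' ∘ T = w (φ ∘ T)'`; the integration by parts is then that of `f w`
  -- against `φ ∘ T`.
  obtain ⟨hs, hds⟩ := isSmoothFun_one_of_hasDerivAt (φ := fun x => φ (T x))
    (ψ := fun x => torusDeriv φ (T x) * (w x)⁻¹)
    ((hφ1.continuous_torusDeriv.comp hTc).mul (hw.continuous.inv₀ fun x => (hw0 x).ne'))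
    fun t => by
      simp only [hF]
      exact (hφ1.hasDerivAt (F t)).comp t (hd t)
  have e := (hfg.mul_smooth hw).integral_mul_torusDeriv hs
  rw [hds] at e
  rw [hp.2.2 _ hφ1.continuous_torusDeriv, hq.2.2 _ hφ.continuous, ← e]
  congr 1
  funext x
  have := (hw0 x).ne'
  field_simp


/-! ### Perturbations of linear expanding maps -/

/-- A continuous integer-valued function on the line is constant. -/
theorem eq_of_continuous_of_int_valued {D : ℝ → ℝ} (hD : Continuous D)
    (h : ∀ t, ∃ n : ℤ, D t = n) (s t : ℝ) : D s = D t := by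
  choose n hn using h
  have hc : Continuous n := Int.isClosedEmbedding_coe_real.isInducing.continuous_iff.2 <| by
    rw [show ((fun m : ℤ => (m : ℝ)) ∘ n) = D from funext fun t => (hn t).symm]
    exact hD
  rw [hn, hn, PreconnectedSpace.constant inferInstance hc]

theorem exists_int_of_coe_eq {s t : ℝ} (h : (s : Torus) = (t : Torus)) :
    ∃ n : ℤ, s - t = n := by
  rw [← sub_eq_zero, ← AddCircle.coe_sub, AddCircle.coe_eq_zero_iff] at h
  obtain ⟨n, hn⟩ := h
  exact ⟨n, by rw [← hn]; simp⟩

theorem IsC4Lift.eq_linear {F : ℝ → ℝ} {k : ℕ} (h : IsC4Lift F (linearMap k)) :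
    F = fun t => k * t + F 0 := by
  funext t
  have := eq_of_continuous_of_int_valued (D := fun t => F t - k * t)
    (h.1.continuous.sub (by fun_prop)) (fun t => exists_int_of_coe_eq <| by
      rw [← h.2 t]
      simp only [linearMap, ← nsmul_eq_mul]
      rfl) t 0
  simp only [mul_zero, sub_zero] at this
  linarith

theorem IsC4Lift.exists_add_one {F : ℝ → ℝ} {S : Torus → Torus} (h : IsC4Lift F S) :
    ∃ d, ∀ t, F (t + 1) = F t + d := by
  have hc := h.1.continuous
  refine ⟨F (0 + 1) - F 0, fun t => ?_⟩
  have : F (t + 1) - F t = F (0 + 1) - F 0 :=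
    eq_of_continuous_of_int_valued (D := fun t => F (t + 1) - F t)
      (by fun_prop) (fun t => exists_int_of_coe_eq <| by
        rw [← h.2, ← h.2, AddCircle.coe_add, AddCircle.coe_period, add_zero]) t 0
  linarith

theorem periodic_deriv_of_add_const {F : ℝ → ℝ} {d : ℝ} (h : ∀ t, F (t + 1) = F t + d) :
    Function.Periodic (deriv F) 1 := by
  intro t
  rw [← deriv_comp_add_const, show (fun t => F (t + 1)) = fun t => F t + d from funext h,
    deriv_add_const]

theorem _root_.Function.Periodic.deriv_one {F : ℝ → ℝ} (h : Function.Periodic F 1) :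
    Function.Periodic (deriv F) 1 :=
  periodic_deriv_of_add_const (d := 0) fun t => by rw [h t, add_zero]

/-- `T` is a circle map whose lift has derivative `1 / w`, with quantitative bounds on `w`. -/
structure IsNearLinear (T : Torus → Torus) (w : Torus → ℝ) (ε : ℝ) : Prop where
  hasInvDeriv : HasInvDeriv T w
  smooth : IsSmoothFun 1 w
  smooth_deriv : IsSmoothFun 1 (torusDeriv w)
  abs_le : ∀ x, |w x| ≤ 4 / 7
  abs_deriv_le : ∀ x, |torusDeriv w x| ≤ ε
  abs_deriv_deriv_le : ∀ x, |torusDeriv (torusDeriv w) x| ≤ 3 * ε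

/-- Take `w = 1 / F'`. Every lift of the linear map has derivative `k` and zero higher derivatives,
so `F'` is within `ε` of `k` and `F''`, `F'''` are at most `ε` in size. -/
theorem exists_isNearLinear {k : ℕ} (hk : 2 ≤ k) {T : Torus → Torus} {ε : ℝ} (hε0 : 0 ≤ ε)
    (hε : ε ≤ 1 / 100) (h : C4DistLE (linearMap k) T ε) : ∃ w, IsNearLinear T w ε := by
  obtain ⟨-, F₀, F, hF₀, hF, hd⟩ := h
  have hk' : (2 : ℝ) ≤ k := by exact_mod_cast hk
  have e1 : deriv F₀ = fun _ => (k : ℝ) := by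
    rw [hF₀.eq_linear]
    funext t
    simp
  have b1 := hd 1 (by simp)
  have b2 := hd 2 (by simp)
  have b3 := hd 3 (by simp)
  simp only [iteratedDeriv_succ, iteratedDeriv_zero, e1, deriv_const', zero_sub, abs_neg] at b1 b2 b3
  have c1 : ContDiff ℝ 3 (deriv F) := by
    have := hF.1
    rw [show (4 : WithTop ℕ∞) = 3 + 1 by norm_num, contDiff_succ_iff_deriv] at this
    exact this.2.2
  have c2 : ContDiff ℝ 2 (deriv (deriv F)) := by
    have := c1
    rw [show (3 : WithTop ℕ∞) = 2 + 1 by norm_num, contDiff_succ_iff_deriv] at this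
    exact this.2.2
  have c3 : Continuous (deriv (deriv (deriv F))) := c2.continuous_deriv (by norm_num)
  obtain ⟨d, hdd⟩ := hF.exists_add_one
  have p1 := periodic_deriv_of_add_const hdd
  have p2 := p1.deriv_one
  have p3 := p2.deriv_one
  have d0 : ∀ t, HasDerivAt F (deriv F t) t := fun t =>
    (hF.1.differentiable (by norm_num) t).hasDerivAt
  have d1 : ∀ t, HasDerivAt (deriv F) (deriv (deriv F) t) t := fun t =>
    (c1.differentiable (by norm_num) t).hasDerivAt
  have d2 : ∀ t, HasDerivAt (deriv (deriv F)) (deriv (deriv (deriv F)) t) t := fun t =>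
    (c2.differentiable (by norm_num) t).hasDerivAt
  set F1 := deriv F
  set F2 := deriv F1
  set F3 := deriv F2
  -- From `k - ε ≥ 2 - 1/100`; the reciprocal is the bound `4 / 7`.
  have l1 : ∀ t, 7 / 4 ≤ F1 t := fun t => by linarith [(abs_le.1 (b1 t)).2]
  have n1 : ∀ t, F1 t ≠ 0 := fun t => by linarith [l1 t]
  have q0 : Function.Periodic (fun t => (F1 t)⁻¹) 1 := fun t => by simp only [p1 t]
  have q1 : Function.Periodic (fun t => -F2 t / F1 t ^ 2) 1 := fun t => by simp only [p1 t, p2 t]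
  have q2 : Function.Periodic (fun t => -F3 t / F1 t ^ 2 + 2 * F2 t ^ 2 / F1 t ^ 3) 1 := fun t => by
    simp only [p1 t, p2 t, p3 t]
  have s0 := isSmoothFun_one_of_hasDerivAt (φ := q0.lift) (ψ := q1.lift)
    (continuous_of_lift (φ := q1.lift)
      ((c2.continuous.neg).div (c1.continuous.pow 2) fun t => pow_ne_zero 2 (n1 t)))
    fun t => (d1 t).inv (n1 t)
  have s1 := isSmoothFun_one_of_hasDerivAt (φ := q1.lift) (ψ := q2.lift)
    (continuous_of_lift (φ := q2.lift)
      (((c3.neg).div (c1.continuous.pow 2) fun t => pow_ne_zero 2 (n1 t)).add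
        (((c2.continuous.pow 2).const_mul 2).div (c1.continuous.pow 3)
          fun t => pow_ne_zero 3 (n1 t))))
    fun t => by
      have := (d2 t).neg.div ((d1 t).pow 2) (pow_ne_zero 2 (n1 t))
      refine this.congr_deriv ?_
      have hn := n1 t
      change _ = -F3 t / F1 t ^ 2 + 2 * F2 t ^ 2 / F1 t ^ 3
      simp only [Pi.neg_apply, Pi.pow_apply]
      field_simp
      ring
  have one_le : ∀ t (n : ℕ), 1 ≤ F1 t ^ n := fun t n => one_le_pow₀ (by linarith [l1 t])
  have div_le : ∀ t (n : ℕ) (x : ℝ), |x / F1 t ^ n| ≤ |x| := fun t n x => by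
    rw [abs_div, abs_of_pos (by linarith [one_le t n] : 0 < F1 t ^ n)]
    exact div_le_self (abs_nonneg _) (one_le t n)
  refine ⟨q0.lift, ⟨fun x => ?_, F, hF.2, fun t => ?_⟩, s0.1, by rw [s0.2]; exact s1.1,
    fun x => ?_, fun x => ?_, fun x => ?_⟩
  · obtain ⟨t, rfl⟩ := torus_surj x
    exact inv_pos.2 (by linarith [l1 t])
  · rw [q0.lift_coe, inv_inv]
    exact d0 t
  · obtain ⟨t, rfl⟩ := torus_surj x
    rw [q0.lift_coe, abs_of_pos (inv_pos.2 (by linarith [l1 t]))]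
    exact inv_le_of_inv_le₀ (by norm_num) (by norm_num; linarith [l1 t])
  · obtain ⟨t, rfl⟩ := torus_surj x
    rw [s0.2, q1.lift_coe]
    exact (div_le t 2 _).trans (by rw [abs_neg]; exact b2 t)
  · obtain ⟨t, rfl⟩ := torus_surj x
    rw [s0.2, s1.2, q2.lift_coe]
    refine (abs_add_le _ _).trans ((add_le_add (div_le t 2 _) (div_le t 3 _)).trans ?_)
    rw [abs_neg, abs_mul, abs_pow, abs_two]
    nlinarith [b3 t, b2 t, abs_nonneg (F2 t)]

/-! ### Estimates for one step of the operator -/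

namespace IsNearLinear

variable {T : Torus → Torus} {w : Torus → ℝ} {ε : ℝ}

theorem integral_abs_le (hT : IsNearLinear T w ε) {f g : Torus → ℝ} (hf : Integrable f volume)
    (hg : Integrable g volume) :
    ∫ x, |g x * w x + f x * torusDeriv w x| ≤ 4 / 7 * (∫ x, |g x|) + ε * ∫ x, |f x| := by
  rw [← integral_const_mul, ← integral_const_mul,
    ← integral_add (hg.abs.const_mul _) (hf.abs.const_mul _)]
  refine integral_mono ((hT.smooth.continuous.integrable_mul_torus hg).add
    (hT.smooth.continuous_torusDeriv.integrable_mul_torus hf)).abs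
    ((hg.abs.const_mul _).add (hf.abs.const_mul _)) fun x => ?_
  refine (abs_add_le _ _).trans ?_
  rw [abs_mul, abs_mul]
  have h1 := mul_le_mul_of_nonneg_left (hT.abs_le x) (abs_nonneg (g x))
  have h2 := mul_le_mul_of_nonneg_left (hT.abs_deriv_le x) (abs_nonneg (f x))
  simp only
  linarith

/-- Push-forward of a weakly differentiable density. -/
theorem exists_weakDeriv (hT : IsNearLinear T w ε) {f g p : Torus → ℝ} (h : HasWeakDeriv f g)
    (hp : IsPush T f p) : ∃ q, HasWeakDeriv p q ∧
      IsPush T (fun x => g x * w x + f x * torusDeriv w x) q ∧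
      ∫ x, |q x| ≤ 4 / 7 * (∫ x, |g x|) + ε * ∫ x, |f x| := by
  obtain ⟨q, hq⟩ := hT.hasInvDeriv.exists_isPush (h.mul_smooth hT.smooth).2.1
  exact ⟨q, hp.hasWeakDeriv hT.hasInvDeriv hT.smooth h hq, hq,
    hq.integral_abs_le.trans (hT.integral_abs_le h.1 h.2.1)⟩

/-- Invariant densities of maps close to a linear one have small second derivatives. -/
theorem integral_abs_second_deriv_le (hT : IsNearLinear T w ε) (hε0 : 0 ≤ ε)
    (hε : ε ≤ 1 / 100) {a : ℝ} {h h1 h2 : Torus → ℝ} (hh : HasWeakDeriv h h1)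
    (hh1 : HasWeakDeriv h1 h2) (hp : IsPush T (translate a h) h) (hone : ∫ x, |h x| = 1) :
    ∫ x, |h2 x| ≤ 11 * ε := by
  obtain ⟨q, hq, hqp, hqb⟩ := hT.exists_weakDeriv (hh.translate a) hp
  -- Invariance makes `q` a second weak derivative of `h`, alongside `h1`, so the push-forward
  -- estimate for `q` becomes one for `h1` itself. The same is done one order higher with `r`.
  have hae := hh.unique hq
  have hu := ((hh1.translate a).mul_smooth hT.smooth).add
    ((hh.translate a).mul_smooth hT.smooth_deriv)
  obtain ⟨r, hr, -, hrb⟩ := hT.exists_weakDeriv hu hqp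
  have hae2 := hh1.unique (hr.congr hae.symm (ae_eq_refl r))
  have A : ∫ x, |h1 x| = ∫ x, |q x| :=
    integral_congr_ae (by filter_upwards [hae] with x hx; rw [hx])
  have B : ∫ x, |h2 x| = ∫ x, |r x| :=
    integral_congr_ae (by filter_upwards [hae2] with x hx; rw [hx])
  have ub := hT.integral_abs_le (hh.translate a).1 (hh.translate a).2.1
  have i1 := (hh1.translate a).mul_smooth hT.smooth
  have i2 := (hh.translate a).mul_smooth hT.smooth_deriv
  have vb1 := hT.integral_abs_le (hh1.translate a).1 (hh1.translate a).2.1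
  have j1 := hT.smooth_deriv.continuous.integrable_mul_torus (hh.translate a).2.1
  have j2 := hT.smooth_deriv.continuous_torusDeriv.integrable_mul_torus (hh.translate a).1
  have vb2 : ∫ x, |translate a h1 x * torusDeriv w x +
      translate a h x * torusDeriv (torusDeriv w) x| ≤
      ε * (∫ x, |translate a h1 x|) + 3 * ε * ∫ x, |translate a h x| := by
    rw [← integral_const_mul, ← integral_const_mul,
      ← integral_add ((hh.translate a).2.1.abs.const_mul _) ((hh.translate a).1.abs.const_mul _)]
    refine integral_mono (j1.add j2).abs (((hh.translate a).2.1.abs.const_mul _).add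
      ((hh.translate a).1.abs.const_mul _)) fun x => ?_
    refine (abs_add_le _ _).trans ?_
    rw [abs_mul, abs_mul]
    have e1 := mul_le_mul_of_nonneg_left (hT.abs_deriv_le x) (abs_nonneg (translate a h1 x))
    have e2 := mul_le_mul_of_nonneg_left (hT.abs_deriv_deriv_le x) (abs_nonneg (translate a h x))
    simp only
    linarith
  have vb := (integral_mono (i1.2.1.add i2.2.1).abs (i1.2.1.abs.add i2.2.1.abs)
    fun x => abs_add_le _ _).trans_eq (integral_add i1.2.1.abs i2.2.1.abs)
  simp only [integral_abs_translate, hone, Pi.add_apply] at hqb ub vb1 vb2 vb hrb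
  rw [← A] at hqb
  rw [← B] at hrb
  have A0 : 0 ≤ ∫ x, |h1 x| := by positivity
  set X := ∫ x, |h1 x|
  set Y := ∫ x, |h2 x|
  -- `X ≤ 4/7 X + ε` gives `X = O(ε)`, and then `Y ≤ (4/7)² Y + O(ε)`; both leading terms are
  -- absorbed on the left. The constant `11` is not sharp.
  have m1 := mul_le_mul_of_nonneg_left ub hε0
  have m2 : ε * X ≤ 1 / 100 * X := mul_le_mul_of_nonneg_right hε A0
  have m3 : ε * (4 / 7 * X + ε * 1) ≤ 1 / 100 * (4 / 7 * X + ε * 1) :=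
    mul_le_mul_of_nonneg_right hε (by positivity)
  linarith

/-- One step of the self-consistent operator on densities. -/
theorem _root_.STO.selfConsistentOp_densityMeasure {T : Torus → Torus} (H : Torus → ℝ) (δ : ℝ) {η : Torus → ℝ}
    (hη : IsProbDensity η) :
    selfConsistentOp δ H T (densityMeasure η) =
      (densityMeasure (translate (δ * ∫ x, η x * H x) η)).map T := by
  unfold selfConsistentOp
  rw [← densityMeasure_map_translate hη, ← integral_densityMeasure hη.1 hη.2.1]
  rfl

/-- The derivative of the distance to a fixed density contracts. -/
theorem exists_contraction (hT : IsNearLinear T w ε) (hε0 : 0 ≤ ε) (hε : ε ≤ 1 / 100)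
    {H : Torus → ℝ} (hH : Continuous H) {M δ : ℝ} (hδ : 0 < δ) (hM0 : 0 ≤ M)
    (hM : ∀ x, |H x| ≤ M) (hεM : 220 * (δ * M) * ε ≤ 1) {h h1 h2 : Torus → ℝ}
    (hh : HasWeakDeriv h h1) (hh1 : HasWeakDeriv h1 h2) (hprob : IsProbDensity h)
    (hfix : selfConsistentOp δ H T (densityMeasure h) = densityMeasure h) {η η1 : Torus → ℝ}
    (hη : HasWeakDeriv η η1) (hηp : IsProbDensity η) :
    ∃ f f1, HasWeakDeriv f f1 ∧ IsProbDensity f ∧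
      selfConsistentOp δ H T (densityMeasure η) = densityMeasure f ∧
      ∫ x, |f1 x - h1 x| ≤ 2 / 3 * ∫ x, |η1 x - h1 x| := by
  have hTc := hT.hasInvDeriv.continuous
  rw [selfConsistentOp_densityMeasure H δ hprob] at hfix
  rw [selfConsistentOp_densityMeasure H δ hηp]
  set a := δ * ∫ x, h x * H x with ha
  set b := δ * ∫ x, η x * H x with hb
  have hpush := isPush_of_map_eq hTc (hprob.translate a).1 (hprob.translate a).2.1 hprob.1
    hprob.2.1 hfix
  obtain ⟨f, hf, hf0, hfm⟩ := hT.hasInvDeriv.exists_map_eq (hηp.translate b).1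
  have hfpush := isPush_of_map_eq hTc (hηp.translate b).1 (hηp.translate b).2.1 hf
    (Eventually.of_forall hf0) hfm
  have hone : ∫ x, |h x| = 1 := by
    refine Eq.trans ?_ hprob.2.2
    exact integral_congr_ae (by filter_upwards [hprob.2.1] with x hx; rw [abs_of_nonneg hx])
  have hB := hT.integral_abs_second_deriv_le hε0 hε hh hh1 hpush hone
  have hu := (hη.translate b).sub (hh.translate a)
  obtain ⟨q, hq, -, hqb⟩ := hT.exists_weakDeriv hu (hfpush.sub hTc hpush)
  have hu0 : ∫ x, (translate b η x - translate a h x) = 0 := by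
    rw [integral_sub (hη.translate b).1 (hh.translate a).1, integral_translate,
      integral_translate, hηp.2.2, hprob.2.2, sub_self]
  have hP := poincare hu hu0
  have hd := hη.sub hh
  have hP' := poincare hd (by rw [integral_sub hη.1 hh.1, hηp.2.2, hprob.2.2, sub_self])
  have hab : |b - a| ≤ δ * M * ∫ x, |η x - h x| := by
    have e := abs_integral_mul_le hd.1 hM
    simp only [sub_mul] at e
    rw [integral_sub (hH.integrable_mul_torus hη.1) (hH.integrable_mul_torus hh.1)] at e
    rw [hb, ha, ← mul_sub, abs_mul, abs_of_pos hδ]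
    linarith [mul_le_mul_of_nonneg_left e hδ.le]
  -- Split into the common translate of `η1 - h1` and the shift mismatch of `h1`; only the latter
  -- needs the second derivative of `h`.
  have hu1 : ∫ x, |translate b η1 x - translate a h1 x| ≤
      (∫ x, |η1 x - h1 x|) + |b - a| * ∫ x, |h2 x| := by
    have e1 := integral_abs_translate_sub_le hh1 a b
    have k1 := (hd.translate b).2.1.abs
    have k2 := ((hh1.translate b).1.sub (hh1.translate a).1).abs
    have e2 : ∫ x, |translate b η1 x - translate a h1 x| ≤
        ∫ x, (|translate b (fun x => η1 x - h1 x) x| + |translate b h1 x - translate a h1 x|) := by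
      refine integral_mono hu.2.1.abs (k1.add k2) fun x => ?_
      refine le_trans (le_of_eq ?_) (abs_add_le _ _)
      simp only [STO.translate]
      congr 1
      ring
    refine e2.trans ((integral_add k1 k2).le.trans (add_le_add ?_ e1))
    exact (integral_abs_translate b fun x => η1 x - h1 x).le
  refine ⟨f, fun x => q x + h1 x, ?_, ⟨hf, Eventually.of_forall hf0, ?_⟩, hfm, ?_⟩
  · have := hq.add hh
    simpa only [sub_add_cancel] using this
  · rw [hfpush.integral_eq, integral_translate, hηp.2.2]
  · simp only [add_sub_cancel_right]
    have D0 : 0 ≤ ∫ x, |η1 x - h1 x| := by positivity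
    have U0 : 0 ≤ ∫ x, |translate b η1 x - translate a h1 x| := by positivity
    set D := ∫ x, |η1 x - h1 x|
    set U := ∫ x, |translate b η1 x - translate a h1 x|
    have hδM : 0 ≤ δ * M := by positivity
    have hab' : |b - a| ≤ δ * M * (2 * D) :=
      hab.trans (mul_le_mul_of_nonneg_left hP' hδM)
    have s1 : |b - a| * ∫ x, |h2 x| ≤ δ * M * (2 * D) * (11 * ε) :=
      mul_le_mul hab' hB (by positivity) (by positivity)
    have s2 : δ * M * (2 * D) * (11 * ε) ≤ 1 / 10 * D := by
      nlinarith
    -- Here `U ≤ 11/10 D`, so the new derivative is at most `(4/7 + 2/100) · 11/10 · D`, and this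
    -- factor is below `2/3`.
    have s3 := mul_le_mul_of_nonneg_left hP hε0
    have s4 : ε * (2 * U) ≤ 1 / 100 * (2 * U) :=
      mul_le_mul_of_nonneg_right hε (by positivity)
    linarith

end IsNearLinear

end STO

/-! ### Iteration of the contraction -/

theorem mainTheorem3 (k : ℕ) (hk : 2 ≤ k) (H : STO.Torus → ℝ) (hH : STO.IsSmoothFun 4 H)
    (δ : ℝ) (hδ : 0 < δ) :
    ∃ ε₀ C ϱ rate : ℝ, 0 < ε₀ ∧ 0 < C ∧ 0 < ϱ ∧ 0 < rate ∧
      ∀ T : ℝ → STO.Torus → STO.Torus,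
        (∀ ε ∈ Set.Icc 0 ε₀, STO.C4DistLE (STO.linearMap k) (T ε) ε) →
        (∃ σ : ℝ, 1 < σ ∧ ∀ ε ∈ Set.Icc 0 ε₀, STO.DerivGE (T ε) σ) →
        ∀ ε ∈ Set.Icc 0 ε₀, ∀ h : STO.Torus → ℝ,
          STO.MemSobolev 3 h → STO.IsProbDensity h →
          STO.selfConsistentOp δ H (T ε) (STO.densityMeasure h) = STO.densityMeasure h →
          ∀ η : STO.Torus → ℝ,
            STO.MemSobolev 1 η → STO.IsProbDensity η →
            STO.sobolevNorm (fun x => h x - η x) ≤ ϱ →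
            ∀ n : ℕ, ∃ f : STO.Torus → ℝ,
              STO.MemSobolev 1 f ∧ STO.IsProbDensity f ∧
              (STO.selfConsistentOp δ H (T ε))^[n] (STO.densityMeasure η) =
                STO.densityMeasure f ∧
              STO.sobolevNorm (fun x => h x - f x) ≤ C * Real.exp (-rate * n) := by
  obtain ⟨M, hM0, hM⟩ := STO.exists_bound_torus hH.continuous
  have hδM : 0 ≤ δ * M := by positivity
  -- The `+ 1` avoids dividing by zero when `M = 0`. `C = 3` is one plus the Poincaré constant `2`,
  -- and the rate encodes the factor `2/3`. The contraction is global among densities in `W^{1,1}`,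
  -- so the radius `1` only normalises the initial bound.
  refine ⟨min (1 / 100) (1 / (220 * (δ * M) + 1)), 3, 1, Real.log (3 / 2), by positivity,
    by norm_num, one_pos, Real.log_pos (by norm_num), ?_⟩
  intro T hT _ ε hε h hh hhp hfix η hη hηp hdist n
  have hε1 : ε ≤ 1 / 100 := hε.2.trans (min_le_left _ _)
  have hε2 : 220 * (δ * M) * ε ≤ 1 := by
    have h1 := hε.2.trans (min_le_right _ _)
    rw [le_div_iff₀ (by positivity)] at h1
    linarith [hε.1]
  obtain ⟨w, hw⟩ := STO.exists_isNearLinear hk hε.1 hε1 (hT ε hε)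
  obtain ⟨h1, hh1, h2, hh2, -⟩ := hh
  obtain ⟨η1, hη1, -⟩ := hη
  have key : ∀ n : ℕ, ∃ f f1, STO.HasWeakDeriv f f1 ∧ STO.IsProbDensity f ∧
      (STO.selfConsistentOp δ H (T ε))^[n] (STO.densityMeasure η) = STO.densityMeasure f ∧
      ∫ x, |f1 x - h1 x| ≤ (2 / 3) ^ n := by
    intro n
    induction n with
    | zero =>
      refine ⟨η, η1, hη1, hηp, rfl, ?_⟩
      rw [(hh1.sub hη1).sobolevNorm_eq] at hdist
      have h0 : 0 ≤ ∫ x, |h x - η x| := by positivity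
      simp only [abs_sub_comm (η1 _), pow_zero]
      linarith
    | succ n ih =>
      obtain ⟨f, f1, hf, hfp, hfm, hfb⟩ := ih
      obtain ⟨g, g1, hg, hgp, hgm, hgb⟩ := hw.exists_contraction hε.1 hε1 hH.continuous hδ hM0 hM
        hε2 hh1 hh2 hhp hfix hf hfp
      refine ⟨g, g1, hg, hgp, ?_, ?_⟩
      · rw [Function.iterate_succ_apply', hfm, hgm]
      · rw [pow_succ]
        linarith
  obtain ⟨f, f1, hf, hfp, hfm, hfb⟩ := key n
  refine ⟨f, ⟨f1, hf, hf.2.1⟩, hfp, hfm, ?_⟩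
  have hd := hh1.sub hf
  have hP := STO.poincare hd (by
    rw [integral_sub hh1.1 hf.1, hhp.2.2, hfp.2.2, sub_self])
  have hexp : Real.exp (-Real.log (3 / 2) * n) = (2 / 3) ^ n := by
    rw [mul_comm, Real.exp_nat_mul, Real.exp_neg, Real.exp_log (by norm_num)]
    norm_num
  rw [hd.sobolevNorm_eq, hexp]
  simp only [abs_sub_comm (f1 _)] at hfb
  linarith
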